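/- **Setting.** Let $\mathcal Z=\mathcal X\times\mathcal Y$ with $\mathcal Y$ finite, let $h(x,\theta)$ be a probability vector on $\mathcal Y$ for $x\in\mathcal X$, $\theta\in\mathbb R^p$, and for $z=(x,y)$ put $L(z,\theta)=-\ln h(x,\theta)_y$, $p(z,\theta)=e^{-L(z,\theta)}$, $f(z,\theta)=\ln\frac{p(z,\theta)}{1-p(z,\theta)}$. Let $S=(z_1,\dots,z_n)$ be a training set in $\mathcal Z$ and $1\le a\le n$. Let $\theta^*_S$ and $\theta^*_A$ be minimizers, with finite risk, of the average loss over $S$ and over each $A\subset S$ with $|A|=a$. Assume that $h(x_i,\cdot)_{y_i}$ is differentiable at $\theta_S^*$ for each training example $z_i=(x_i,y_i)$. Let $A$ be uniformly distributed on the subsets of $S$ of size $a$ ($\mathbb E_A$ is the expectation). Let $J\in\mathbb R^{n\times p}$ have rows $\nabla_\theta L(z_i,\theta^*_S)^\top$, let $F_S=\frac1nJ^\top J$, and for $\lambda>0$ let $$\tau_\lambda(z',z_i)=-\nabla_\theta f(z',\theta_S^*)^\top(F_S+\lambda I_p)^{-1}\nabla_\theta L(z_i,\theta_S^*).$$ Let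 $c_p(\lambda;z')$ be the Pearson correlation, over all $A\subset S$ with $|A|=a$, of $f(z',\theta_A^*)$ and $\sum_{z\in A}\tau_\lambda(z',z)$. Put $\alpha_{z',i}=\mathbb E_A[f(z',\theta_A^*)\mid z_i\in A]-\mathbb E_A[f(z',\theta_A^*)]$, $g_{z'}=\frac1n\sum_i\alpha_{z',i}\nabla_\theta L(z_i,\theta^*_S)$ and $r_{z',\lambda}=-\nabla_\theta f(z',\theta_S^*)^\top(F_S+\lambda I_p)^{-1}g_{z'}$. Fix an orthonormal eigenbasis of $F_S$ with eigenvalues $\mu_1\ge\dots\ge\mu_p$. For $v\in\mathbb R^p$ let $\tilde v_i$ be the $i$-th component of $v$ in this basis, and put $\mu_i=0$, $\tilde v_i=0$ for $i>p$. Let $\mu_{\min}$ be the smallest nonzero eigenvalue of $F_S$. Let the test example $z'$ have law $\mathcal P$ on $\mathcal Z$, and assume that for almost every $z'=(x',y')$ the numbers $h(x',\theta^*_S)_{y'}$ and $h(x',\theta_A^*)_{y'}$ ($|A|=a$) lie in $(0,1)$ and $h(x',\cdot)_{y'}$ is differentiable at $\theta_S^*$. **Assumptions.** Let $\delta\ge0$.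 1. There are constants $0<C_1<C_2$ such that, except on a set of $z'$ of probability at most $\delta$, for $i=1,\dots,n$, $$C_1\,\frac1n\sum_{k=1}^n\widetilde{\nabla_\theta L}_i(z_k,\theta_S^*)^2\le\widetilde{\nabla_\theta L}_i(z',\theta_S^*)^2\le C_2\,\frac1n\sum_{k=1}^n\widetilde{\nabla_\theta L}_i(z_k,\theta_S^*)^2 .$$ 2. For almost every $z'$ there are $C_3>0$ and $\varepsilon>0$ (which may depend on $z'$) with $\tilde g_{z',i}^2\le C_3\,\mu_i^{1+\varepsilon}$ for $i=1,\dots,n$. 3. For almost every $z'$, $\alpha_{z'}$ lies in the column space of $J$. **Conclusion.** Except on a set of $z'$ of probability at most $\delta$, the limit $r_{z',0^+}=\lim_{\lambda\to0^+}r_{z',\lambda}$ exists; and if moreover $r_{z',0^+}>0$ and $\mu_{\min}<C_\mu$, then there is $C>0$ such that for all $0<\lambda<C$ the derivative $\frac{\partial c_p}{\partial\lambda}(\lambda;z')$ exists and is positive. Here $C_\mu>0$ is a function of $n,C_1,C_2,C_3,\varepsilon,r_{z',0^+}$ and $p(z',\theta_S^*)$ only and, in the case $\varepsilon>2$, also of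 an upper bound $M$ of the eigenvalues of $F_S$; this function does not depend on the model, the data or the test distribution. -/

import Mathlib

open Filter Topology MeasureTheory
open scoped BigOperators ENNReal Matrix

noncomputable section

/-- The parameter space `ℝᵖ` with the Euclidean norm. -/
abbrev Param (p : ℕ) := EuclideanSpace ℝ (Fin p)

/-- Pearson correlation of two real-valued variables under the uniform distribution on the
finite set `D`. -/
def pearsonCorr {ι : Type*} (D : Finset ι) (u v : ι → ℝ) : ℝ :=
  (𝔼 A ∈ D, (u A - 𝔼 B ∈ D, u B) * (v A - 𝔼 B ∈ D, v B)) /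
    (Real.sqrt (𝔼 A ∈ D, (u A - 𝔼 B ∈ D, u B) ^ 2) *
      Real.sqrt (𝔼 A ∈ D, (v A - 𝔼 B ∈ D, v B) ^ 2))

/-- The data of a classification problem with retraining on subsets: the hypothesis function
`h x θ y` (probability of class `y` for the input `x`), the training examples `S i = (xᵢ, yᵢ)`,
the size `a` of the subsets, and the parameter `θs A` trained on the subset `A` (subsets of the
training set are sets of indices). -/
structure Problem (X Y : Type*) (n p : ℕ) where
  h : X → Param p → Y → ℝ
  S : Fin n → X × Y
  a : ℕ
  θs : Finset (Fin n) → Param p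

namespace Problem

variable {X Y : Type*} {n p : ℕ} (Q : Problem X Y n p)

/-- The parameter trained on the whole training set. -/
def θS : Param p := Q.θs Finset.univ

/-- Cross-entropy loss of the example `z = (x, y)`. -/
def loss (z : X × Y) (θ : Param p) : ℝ := -Real.log (Q.h z.1 θ z.2)

/-- Predicted probability of the correct class, `exp (-L(z, θ))`. -/
def prob (z : X × Y) (θ : Param p) : ℝ := Real.exp (-Q.loss z θ)

/-- Model output `f(z, θ) = ln (p(z, θ) / (1 - p(z, θ)))`. -/
def output (z : X × Y) (θ : Param p) : ℝ :=
  Real.log (Q.prob z θ / (1 - Q.prob z θ))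

/-- Empirical risk over the subset `A`. -/
def risk (A : Finset (Fin n)) (θ : Param p) : ℝ :=
  (1 / (A.card : ℝ)) * ∑ i ∈ A, Q.loss (Q.S i) θ

/-- All losses over `A` are finite at `θ` (the cross-entropy is `+∞` where the predicted
probability of the correct class vanishes). -/
def FiniteRisk (A : Finset (Fin n)) (θ : Param p) : Prop :=
  ∀ i ∈ A, 0 < Q.h (Q.S i).1 θ (Q.S i).2

/-- `θ` minimizes the empirical risk over `A`, the risk being `+∞` where it is not finite. -/
def IsRiskMinimizer (A : Finset (Fin n)) (θ : Param p) : Prop :=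
  Q.FiniteRisk A θ ∧ ∀ θ', Q.FiniteRisk A θ' → Q.risk A θ ≤ Q.risk A θ'

/-- Standing assumptions: `h` is valued in the probability simplex, `1 ≤ a ≤ n`, the trained
parameters minimize the empirical risk, and the training gradients exist. -/
structure WellPosed [Fintype Y] : Prop where
  simplex : ∀ x θ, Q.h x θ ∈ stdSimplex ℝ Y
  one_le_a : 1 ≤ Q.a
  a_le_n : Q.a ≤ n
  min_full : Q.IsRiskMinimizer Finset.univ Q.θS
  min_subset : ∀ A : Finset (Fin n), A.card = Q.a → Q.IsRiskMinimizer A (Q.θs A)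
  diff : ∀ i, DifferentiableAt ℝ (fun θ => Q.h (Q.S i).1 θ (Q.S i).2) Q.θS

/-- The quantities attached to the test example `z` are defined: the model output is finite at
all the trained parameters and the gradient at the fully trained one exists. -/
structure Regular (z : X × Y) : Prop where
  full : Q.h z.1 Q.θS z.2 ∈ Set.Ioo (0 : ℝ) 1
  subset : ∀ A : Finset (Fin n), A.card = Q.a → Q.h z.1 (Q.θs A) z.2 ∈ Set.Ioo (0 : ℝ) 1
  diff : DifferentiableAt ℝ (fun θ => Q.h z.1 θ z.2) Q.θS

/-- `∇_θ L(z, θ_S)`. -/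
def gradLoss (z : X × Y) : Param p := gradient (fun θ => Q.loss z θ) Q.θS

/-- `∇_θ f(z, θ_S)`. -/
def gradOutput (z : X × Y) : Param p := gradient (fun θ => Q.output z θ) Q.θS

/-- The matrix `J` whose `i`-th row is the gradient of the loss of the `i`-th training example. -/
def J : Matrix (Fin n) (Fin p) ℝ := Matrix.of fun i j => Q.gradLoss (Q.S i) j

/-- The empirical Fisher information matrix `F_S`. -/
def F : Matrix (Fin p) (Fin p) ℝ :=
  (1 / (n : ℝ)) • ∑ i, Matrix.vecMulVec (Q.gradLoss (Q.S i)).ofLp (Q.gradLoss (Q.S i)).ofLp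

/-- The regularized influence function attributor: the score of the `i`-th training example. -/
def iffim (lam : ℝ) (z : X × Y) (i : Fin n) : ℝ :=
  -((Q.gradOutput z).ofLp ⬝ᵥ
    ((Q.F + lam • (1 : Matrix (Fin p) (Fin p) ℝ))⁻¹ *ᵥ (Q.gradLoss (Q.S i)).ofLp))

/-- The subsets of the training set of size `a`. -/
def subsets : Finset (Finset (Fin n)) := Finset.powersetCard Q.a Finset.univ

/-- The population Pearson LDS of an attributor `τ` for the test example `z`. -/
def pearsonLDS (τ : X × Y → Fin n → ℝ) (z : X × Y) : ℝ :=
  pearsonCorr Q.subsets (fun A => Q.output z (Q.θs A)) (fun A => ∑ i ∈ A, τ z i)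

/-- `λ ↦ c_p(τ_{IFFIM, λ}, z)`. -/
def cp (z : X × Y) (lam : ℝ) : ℝ := Q.pearsonLDS (Q.iffim lam) z

/-- `α_{z, i} = E_A[f(z, θ_A) | z_i ∈ A] - E_A[f(z, θ_A)]`. -/
def alpha (z : X × Y) (i : Fin n) : ℝ :=
  (𝔼 A ∈ Q.subsets with i ∈ A, Q.output z (Q.θs A)) - 𝔼 A ∈ Q.subsets, Q.output z (Q.θs A)

/-- `g_z = (1 / n) ∑ᵢ α_{z, i} ∇_θ L(z_i, θ_S)`. -/
def g (z : X × Y) : Param p :=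
  (1 / (n : ℝ)) • ∑ i, Q.alpha z i • Q.gradLoss (Q.S i)

/-- `r_{z, λ} = -∇_θ f(z, θ_S)ᵀ (F_S + λ I)⁻¹ g_z`. -/
def r (z : X × Y) (lam : ℝ) : ℝ :=
  -((Q.gradOutput z).ofLp ⬝ᵥ
    ((Q.F + lam • (1 : Matrix (Fin p) (Fin p) ℝ))⁻¹ *ᵥ (Q.g z).ofLp))

/-- `b` is an orthonormal eigenbasis of `F_S` with eigenvalues `μ` in descending order. -/
structure IsEigenbasis (b : OrthonormalBasis (Fin p) ℝ (Param p)) (μ : Fin p → ℝ) : Prop where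
  antitone : Antitone μ
  eigen : ∀ i, Q.F *ᵥ (b i).ofLp = μ i • (b i).ofLp

end Problem

/-- The component of `v` along the `i`-th basis vector, and `0` beyond the dimension. -/
def comp {p : ℕ} (b : OrthonormalBasis (Fin p) ℝ (Param p)) (v : Param p) (i : ℕ) : ℝ :=
  if hi : i < p then inner ℝ (b ⟨i, hi⟩) v else 0

/-- The `i`-th eigenvalue, and `0` beyond the dimension. -/
def eig {p : ℕ} (μ : Fin p → ℝ) (i : ℕ) : ℝ := if hi : i < p then μ ⟨i, hi⟩ else 0

namespace Problem

variable {X Y : Type*} {n p : ℕ} (Q : Problem X Y n p)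

/-- The squared eigen-components of the gradient at the test example `z` are comparable to
their averages over the training examples. -/
def Concentrated (b : OrthonormalBasis (Fin p) ℝ (Param p)) (C₁ C₂ : ℝ) (z : X × Y) : Prop :=
  ∀ i < n,
    C₁ * (𝔼 k : Fin n, comp b (Q.gradLoss (Q.S k)) i ^ 2) ≤ comp b (Q.gradLoss z) i ^ 2 ∧
    comp b (Q.gradLoss z) i ^ 2 ≤ C₂ * (𝔼 k : Fin n, comp b (Q.gradLoss (Q.S k)) i ^ 2)

/-- The squared eigen-components of `g_z` are at most `C₃ μᵢ^(1+ε)`. -/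
def BoundedG (b : OrthonormalBasis (Fin p) ℝ (Param p)) (μ : Fin p → ℝ) (C₃ ε : ℝ)
    (z : X × Y) : Prop :=
  ∀ i < n, comp b (Q.g z) i ^ 2 ≤ C₃ * (eig μ i) ^ (1 + ε)

/-- `α_z` lies in the column space of `J`. -/
def AlphaInColumnSpace (z : X × Y) : Prop := Q.alpha z ∈ LinearMap.range Q.J.mulVecLin

end Problem

end

/-! ### Sampling subsets of fixed size without replacement. -/

section SubsetSampling

open Finset

/-! The full-data parameter is an interior critical point of the risk, so the training gradients,
and with them the influence scores `τ i`, sum to zero. For additive scores of zero total, the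
covariance with the model output over subsets of size `a` is a constant times `∑ τ i * α i`, and the
variance is a constant times `∑ τ i ^ 2` (`pearsonCorr_subset_sum`). Let `w` and `g` denote the
eigen-coordinates of the test loss gradient and of `g_z`. Because `∇f` is a negative multiple of
`∇L`, the correlation becomes `K * N(λ) / √D(λ)` with `N(λ) = ∑ w g / (μ + λ)`, `D(λ) = ∑ μ w² / (μ
+ λ)²` and `K > 0` free of `λ` (`cp_eq`). Only nonzero eigenvalues enter, so `N(0)` makes sense and
gives the limit of `r`. The derivative has the sign of an expression continuous in `λ` whose value
at `0` is `N(0) ∑ w²/μ² - (∑ w g/μ²)(∑ w²/μ)`. The average squared training coordinate is exactly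
`μ`, so concentration says `C₁ μ ≤ w² ≤ C₂ μ`. The first product is then at least `N(0) C₁ / μmin`,
while the bound on `g` makes the second grow strictly more slowly as `μmin` shrinks
(`logDeriv_numerator_pos`). A small `μmin` makes the difference positive, and continuity carries
this to small `λ > 0` (`exists_forall_deriv_pos`). -/

theorem card_powersetCard_filter_mem {ι : Type*} [DecidableEq ι] (s : Finset ι) {i : ι}
    (hi : i ∈ s) {a : ℕ} (ha : 1 ≤ a) :
    #{A ∈ powersetCard a s | i ∈ A} = (#s - 1).choose (a - 1) := by
  rw [← card_erase_of_mem hi, ← card_powersetCard]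
  refine card_bij' (fun A _ => A.erase i) (fun B _ => insert i B) ?_ ?_ ?_ ?_
  · intro A hA
    simp only [mem_filter, mem_powersetCard] at hA ⊢
    exact ⟨erase_subset_erase _ hA.1.1, by rw [card_erase_of_mem hA.2, hA.1.2]⟩
  · intro B hB
    simp only [mem_filter, mem_powersetCard] at hB ⊢
    have hiB : i ∉ B := fun h => by simpa using hB.1 h
    refine ⟨⟨insert_subset hi (hB.1.trans (erase_subset _ _)), ?_⟩, mem_insert_self _ _⟩
    rw [card_insert_of_notMem hiB, hB.2]; omega
  · intro A hA
    simp only [mem_filter] at hA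
    exact insert_erase hA.2
  · intro B hB
    simp only [mem_powersetCard] at hB
    exact erase_insert fun h => by simpa using hB.1 h

variable {n a : ℕ}

theorem card_subsets_mem (i : Fin n) (ha : 1 ≤ a) :
    #{A ∈ powersetCard a (univ : Finset (Fin n)) | i ∈ A} = (n - 1).choose (a - 1) := by
  simpa using card_powersetCard_filter_mem univ (mem_univ i) ha

theorem card_subsets_mem_notMem {i j : Fin n} (hij : i ≠ j) (ha : 1 ≤ a) :
    #{A ∈ powersetCard a (univ : Finset (Fin n)) | i ∈ A ∧ j ∉ A} =
      (n - 2).choose (a - 1) := by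
  have h := card_powersetCard_filter_mem (univ.erase j) (mem_erase.2 ⟨hij, mem_univ i⟩) ha
  rw [card_erase_of_mem (mem_univ j), card_univ, Fintype.card_fin, Nat.sub_sub] at h
  rw [← h]
  congr 1
  ext A
  simp only [mem_filter, mem_powersetCard, subset_univ, true_and, subset_erase]
  tauto

/-- Written as a constant plus a diagonal term: against scores of zero total the constant part
vanishes and only the diagonal survives. -/
theorem card_subsets_mem_mem (i j : Fin n) (ha : 1 ≤ a) :
    (#{A ∈ powersetCard a (univ : Finset (Fin n)) | i ∈ A ∧ j ∈ A} : ℝ) =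
      (n - 1).choose (a - 1) - (n - 2).choose (a - 1) +
        if i = j then ((n - 2).choose (a - 1) : ℝ) else 0 := by
  split_ifs with hij
  · subst hij
    simp [card_subsets_mem i ha]
  · have h1 := card_subsets_mem i ha
    rw [← card_filter_add_card_filter_not (fun A => j ∈ A), filter_filter, filter_filter,
      card_subsets_mem_notMem hij ha] at h1
    rw [← h1]
    push_cast
    ring

theorem sum_mul_sum_mem (D : Finset (Finset (Fin n))) (u : Finset (Fin n) → ℝ)
    (τ : Fin n → ℝ) :
    ∑ A ∈ D, u A * ∑ i ∈ A, τ i = ∑ i, τ i * ∑ A ∈ D with i ∈ A, u A := by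
  simp_rw [mul_sum, sum_filter]
  rw [sum_comm]
  refine sum_congr rfl fun A _ => ?_
  rw [← sum_filter_add_sum_filter_not univ (fun i => i ∈ A)]
  simp only [filter_mem_eq_inter, univ_inter]
  rw [sum_eq_zero (s := filter _ _), add_zero]
  · exact sum_congr rfl fun i hi => by simp [hi, mul_comm]
  · intro i hi
    simp [(mem_filter.1 hi).2]

theorem sum_subsets_mem_sum (ha : 1 ≤ a) {τ : Fin n → ℝ} (hτ : ∑ i, τ i = 0) (i : Fin n) :
    ∑ A ∈ powersetCard a (univ : Finset (Fin n)) with i ∈ A, ∑ j ∈ A, τ j =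
      (n - 2).choose (a - 1) * τ i := by
  have h := sum_mul_sum_mem {A ∈ powersetCard a (univ : Finset (Fin n)) | i ∈ A} (fun _ => 1) τ
  simp only [one_mul, filter_filter, sum_const, nsmul_eq_mul, mul_one,
    card_subsets_mem_mem _ _ ha, mul_add, sum_add_distrib, ← sum_mul, hτ, zero_mul,
    zero_add, mul_ite, mul_zero, sum_ite_eq, mem_univ, if_true] at h
  rw [h, mul_comm]

theorem sum_subsets_sum (ha : 1 ≤ a) {τ : Fin n → ℝ} (hτ : ∑ i, τ i = 0) :
    ∑ A ∈ powersetCard a (univ : Finset (Fin n)), ∑ i ∈ A, τ i = 0 := by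
  have h := sum_mul_sum_mem (powersetCard a (univ : Finset (Fin n))) (fun _ => 1) τ
  simpa [card_subsets_mem _ ha, ← sum_mul, hτ] using h

theorem sum_subsets_sum_sq (ha : 1 ≤ a) {τ : Fin n → ℝ} (hτ : ∑ i, τ i = 0) :
    ∑ A ∈ powersetCard a (univ : Finset (Fin n)), (∑ i ∈ A, τ i) ^ 2 =
      (n - 2).choose (a - 1) * ∑ i, τ i ^ 2 := by
  simp_rw [sq]
  rw [sum_mul_sum_mem, mul_sum]
  refine sum_congr rfl fun i _ => ?_
  rw [sum_subsets_mem_sum ha hτ]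
  ring

/-- The Pearson correlation of a variable with an additive one of zero total, under sampling
without replacement. -/
theorem pearsonCorr_subset_sum (ha : 1 ≤ a) (han : a ≤ n) (u : Finset (Fin n) → ℝ)
    {τ : Fin n → ℝ} (hτ : ∑ i, τ i = 0) :
    pearsonCorr (powersetCard a (univ : Finset (Fin n))) u (fun A => ∑ i ∈ A, τ i) =
      ((n - 1).choose (a - 1) / n.choose a *
        ∑ i, τ i * ((𝔼 A ∈ powersetCard a (univ : Finset (Fin n)) with i ∈ A, u A) -
          𝔼 A ∈ powersetCard a (univ : Finset (Fin n)), u A)) /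
      (√(𝔼 A ∈ powersetCard a (univ : Finset (Fin n)),
          (u A - 𝔼 B ∈ powersetCard a (univ : Finset (Fin n)), u B) ^ 2) *
        √((n - 2).choose (a - 1) / n.choose a * ∑ i, τ i ^ 2)) := by
  have hc : ((n - 1).choose (a - 1) : ℝ) ≠ 0 := by
    exact_mod_cast (Nat.choose_pos (by omega)).ne'
  have hv : 𝔼 A ∈ powersetCard a (univ : Finset (Fin n)), ∑ i ∈ A, τ i = 0 := by
    rw [expect_eq_sum_div_card, sum_subsets_sum ha hτ, zero_div]
  unfold pearsonCorr
  simp only [hv, sub_zero]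
  congr 1
  · rw [expect_eq_sum_div_card (powersetCard a (univ : Finset (Fin n)))
        (fun A => (u A - 𝔼 B ∈ powersetCard a (univ : Finset (Fin n)), u B) * ∑ i ∈ A, τ i),
      sum_mul_sum_mem, card_powersetCard,
      card_univ, Fintype.card_fin, div_mul_eq_mul_div, mul_sum]
    congr 1
    refine sum_congr rfl fun i _ => ?_
    rw [expect_eq_sum_div_card (s := filter _ _), card_subsets_mem i ha, sum_sub_distrib, sum_const,
      card_subsets_mem i ha, nsmul_eq_mul]
    field_simp
  · congr 2
    rw [expect_eq_sum_div_card, sum_subsets_sum_sq ha hτ, card_powersetCard,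
      card_univ, Fintype.card_fin]
    ring

/-- Zero variance forces `u` to be constant on the subsets. Contrapositively, a nonzero `α` rules
out a degenerate correlation. -/
theorem condExpect_sub_expect_eq_zero (ha : 1 ≤ a) (han : a ≤ n) {u : Finset (Fin n) → ℝ}
    (hu : 𝔼 A ∈ powersetCard a (univ : Finset (Fin n)),
      (u A - 𝔼 B ∈ powersetCard a (univ : Finset (Fin n)), u B) ^ 2 = 0) (i : Fin n) :
    (𝔼 A ∈ powersetCard a (univ : Finset (Fin n)) with i ∈ A, u A) -
      𝔼 A ∈ powersetCard a (univ : Finset (Fin n)), u A = 0 := by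
  have hD : (#(powersetCard a (univ : Finset (Fin n))) : ℝ) ≠ 0 := by
    rw [card_powersetCard, card_univ, Fintype.card_fin]
    exact_mod_cast (Nat.choose_pos han).ne'
  rw [expect_eq_sum_div_card, div_eq_zero_iff, or_iff_left hD,
    sum_eq_zero_iff_of_nonneg fun _ _ => sq_nonneg _] at hu
  have hne : {A ∈ powersetCard a (univ : Finset (Fin n)) | i ∈ A}.Nonempty := by
    rw [← card_pos, card_subsets_mem i ha]
    exact Nat.choose_pos (by omega)
  rw [sub_eq_zero, expect_congr rfl fun A hA =>
    sub_eq_zero.1 (pow_eq_zero_iff two_ne_zero |>.1 (hu A (mem_filter.1 hA).1)),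
    expect_const hne]

end SubsetSampling

/-! ### Spectral expansion of the resolvent and of the averaged outer products. -/

section EigenbasisExpansion

variable {n p : ℕ} {F : Matrix (Fin p) (Fin p) ℝ} {b : OrthonormalBasis (Fin p) ℝ (Param p)}
  {μ : Fin p → ℝ}

theorem dotProduct_resolvent_mulVec (hF : ∀ i, F *ᵥ (b i).ofLp = μ i • (b i).ofLp) {l : ℝ}
    (hl : ∀ i, μ i + l ≠ 0) (x v : Param p) :
    x.ofLp ⬝ᵥ ((F + l • (1 : Matrix (Fin p) (Fin p) ℝ))⁻¹ *ᵥ v.ofLp) =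
      ∑ i, inner ℝ (b i) x * inner ℝ (b i) v / (μ i + l) := by
  -- An explicit preimage of every vector gives both invertibility and the formula for the inverse.
  have hsol : ∀ v : Param p, (F + l • (1 : Matrix (Fin p) (Fin p) ℝ)) *ᵥ
      (∑ i, (inner ℝ (b i) v / (μ i + l)) • (b i).ofLp) = v.ofLp := by
    intro v
    conv_rhs => rw [← b.sum_repr' v, WithLp.ofLp_sum]
    rw [Matrix.mulVec_sum]
    refine Finset.sum_congr rfl fun i _ => ?_
    rw [Matrix.mulVec_smul, Matrix.add_mulVec, hF, Matrix.smul_mulVec, Matrix.one_mulVec,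
      ← add_smul, smul_smul, div_mul_cancel₀ _ (hl i), WithLp.ofLp_smul]
  have hunit : IsUnit (F + l • (1 : Matrix (Fin p) (Fin p) ℝ)) :=
    Matrix.mulVec_surjective_iff_isUnit.1 fun v => ⟨_, hsol (WithLp.toLp 2 v)⟩
  conv_lhs => rw [← hsol v]
  rw [Matrix.mulVec_mulVec, Matrix.nonsing_inv_mul _ ((Matrix.isUnit_iff_isUnit_det _).1 hunit),
    Matrix.one_mulVec, dotProduct_sum]
  refine Finset.sum_congr rfl fun i _ => ?_
  rw [dotProduct_smul, EuclideanSpace.inner_eq_star_dotProduct (b i) x, star_trivial,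
    smul_eq_mul]
  ring

variable {G : Fin n → Param p}

theorem average_vecMulVec_mulVec (v : Param p) :
    ((1 / (n : ℝ)) • ∑ k, Matrix.vecMulVec (G k).ofLp (G k).ofLp) *ᵥ v.ofLp =
      ((1 / (n : ℝ)) • ∑ k, inner ℝ v (G k) • G k).ofLp := by
  rw [Matrix.smul_mulVec, Matrix.sum_mulVec, WithLp.ofLp_smul, WithLp.ofLp_sum]
  congr 1
  refine Finset.sum_congr rfl fun k _ => ?_
  rw [Matrix.vecMulVec_mulVec, WithLp.ofLp_smul, EuclideanSpace.inner_eq_star_dotProduct,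
    star_trivial, op_smul_eq_smul]

theorem average_inner_smul_eq
    (hF : ∀ i, ((1 / (n : ℝ)) • ∑ k, Matrix.vecMulVec (G k).ofLp (G k).ofLp) *ᵥ
    (b i).ofLp = μ i • (b i).ofLp)
    (i : Fin p) :
    (1 / (n : ℝ)) • ∑ k, inner ℝ (b i) (G k) • G k = μ i • b i := by
  apply WithLp.ofLp_injective 2
  rw [← average_vecMulVec_mulVec, hF, WithLp.ofLp_smul]

/-- The matrix is the second-moment matrix of the `G k`, so in its eigenbasis their coordinates are
uncorrelated, with second moments `μ`. -/
theorem average_inner_mul_inner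
    (hF : ∀ i, ((1 / (n : ℝ)) • ∑ k, Matrix.vecMulVec (G k).ofLp (G k).ofLp) *ᵥ
    (b i).ofLp = μ i • (b i).ofLp)
    (i j : Fin p) :
    (1 / (n : ℝ)) * ∑ k, inner ℝ (b i) (G k) * inner ℝ (b j) (G k) =
      if i = j then μ i else 0 := by
  have h := congrArg (fun v => inner ℝ (b j) v) (average_inner_smul_eq hF i)
  simp only [inner_smul_right, inner_sum, b.inner_eq_ite] at h
  rw [h]
  simp [eq_comm]

theorem eigenvalue_nonneg
    (hF : ∀ i, ((1 / (n : ℝ)) • ∑ k, Matrix.vecMulVec (G k).ofLp (G k).ofLp) *ᵥ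
    (b i).ofLp = μ i • (b i).ofLp)
    (i : Fin p) : 0 ≤ μ i := by
  have h := average_inner_mul_inner hF i i
  rw [if_pos rfl] at h
  rw [← h]
  exact mul_nonneg (by positivity) (Finset.sum_nonneg fun k _ => mul_self_nonneg _)

theorem inner_eq_zero_of_eigenvalue_eq_zero
    (hF : ∀ i, ((1 / (n : ℝ)) • ∑ k, Matrix.vecMulVec (G k).ofLp (G k).ofLp) *ᵥ
    (b i).ofLp = μ i • (b i).ofLp)
    {i : Fin p} (hi : μ i = 0) (k : Fin n) :
    inner ℝ (b i) (G k) = 0 := by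
  have hn : (n : ℝ) ≠ 0 := by
    have := k.pos
    positivity
  have h := average_inner_mul_inner hF i i
  rw [if_pos rfl, hi, mul_eq_zero, or_iff_right (by positivity),
    Finset.sum_eq_zero_iff_of_nonneg fun _ _ => mul_self_nonneg _] at h
  exact mul_self_eq_zero.1 (h k (Finset.mem_univ k))

/-- Eigenvectors with positive eigenvalue lie in the span of the `n` vectors `G k`, and by
monotonicity `b 0, …, b i` are `i + 1` independent such vectors. This lets bounds assumed only for
indices below `n` cover the whole nonzero spectrum. -/
theorem index_lt_of_eigenvalue_pos
    (hF : ∀ i, ((1 / (n : ℝ)) • ∑ k, Matrix.vecMulVec (G k).ofLp (G k).ofLp) *ᵥ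
    (b i).ofLp = μ i • (b i).ofLp)
    (hμ : Antitone μ) {i : Fin p} (hi : 0 < μ i) :
    (i : ℕ) < n := by
  classical
  have hle : (i : ℕ) + 1 ≤ p := i.2
  have hli : LinearIndependent ℝ fun j : Fin (i + 1) => b (Fin.castLE hle j) :=
    b.orthonormal.linearIndependent.comp _ (Fin.castLE_injective hle)
  have hspan : Set.range (fun j : Fin (i + 1) => b (Fin.castLE hle j)) ≤
      Submodule.span ℝ (Set.range G) := by
    rintro _ ⟨j, rfl⟩
    have hj : 0 < μ (Fin.castLE hle j) :=
      hi.trans_le (hμ (Fin.le_def.2 (Nat.lt_succ_iff.1 j.2)))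
    have h := average_inner_smul_eq hF (Fin.castLE hle j)
    rw [← inv_smul_eq_iff₀ hj.ne'] at h
    change b (Fin.castLE hle j) ∈ _
    rw [← h]
    exact Submodule.smul_mem _ _ <| Submodule.smul_mem _ _ <| Submodule.sum_mem _ fun k _ =>
      Submodule.smul_mem _ _ <| Submodule.subset_span ⟨k, rfl⟩
  have h := (linearIndependent_le_span_aux' _ hli _ hspan).trans (Fintype.card_range_le G)
  simpa using h

theorem sum_sq_sum_mul_inner
    (hF : ∀ i, ((1 / (n : ℝ)) • ∑ k, Matrix.vecMulVec (G k).ofLp (G k).ofLp) *ᵥ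
    (b i).ofLp = μ i • (b i).ofLp)
    (hn : n ≠ 0) (c : Fin p → ℝ) :
    ∑ k, (∑ j, c j * inner ℝ (b j) (G k)) ^ 2 = n * ∑ j, μ j * c j ^ 2 := by
  have hn' : (n : ℝ) ≠ 0 := by exact_mod_cast hn
  have h : ∀ i j, ∑ k, inner ℝ (b i) (G k) * inner ℝ (b j) (G k) =
      n * if i = j then μ i else 0 := by
    intro i j
    rw [← average_inner_mul_inner hF i j]
    field_simp
  calc ∑ k, (∑ j, c j * inner ℝ (b j) (G k)) ^ 2
      = ∑ i, ∑ j, c i * c j * ∑ k, inner ℝ (b i) (G k) * inner ℝ (b j) (G k) := by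
        simp_rw [sq, Finset.sum_mul_sum, Finset.mul_sum]
        rw [Finset.sum_comm]
        refine Finset.sum_congr rfl fun i _ => ?_
        rw [Finset.sum_comm]
        exact Finset.sum_congr rfl fun j _ => Finset.sum_congr rfl fun k _ => by ring
    _ = _ := by
        simp_rw [h, Finset.mul_sum]
        refine Finset.sum_congr rfl fun i _ => ?_
        simp only [mul_ite, mul_zero, Finset.sum_ite_eq, Finset.mem_univ, if_true]
        ring

end EigenbasisExpansion

/-! ### Monotonicity of `N / √D` near zero. -/

section CorrelationProfile

variable {ι : Type*} (s : Finset ι) (μ w g : ι → ℝ)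

theorem hasDerivAt_sum_div_add (c : ι → ℝ) {l : ℝ} (h : ∀ i ∈ s, μ i + l ≠ 0) :
    HasDerivAt (fun l => ∑ i ∈ s, c i / (μ i + l)) (-∑ i ∈ s, c i / (μ i + l) ^ 2) l := by
  rw [← Finset.sum_neg_distrib]
  refine HasDerivAt.fun_sum fun i hi => ?_
  have h1 : HasDerivAt (fun l => μ i + l) 1 l := (hasDerivAt_id l).const_add _
  refine ((hasDerivAt_const l (c i)).div h1 (h i hi)).congr_deriv ?_
  ring

theorem hasDerivAt_sum_div_add_sq (c : ι → ℝ) {l : ℝ} (h : ∀ i ∈ s, μ i + l ≠ 0) :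
    HasDerivAt (fun l => ∑ i ∈ s, c i / (μ i + l) ^ 2)
      (-2 * ∑ i ∈ s, c i / (μ i + l) ^ 3) l := by
  rw [Finset.mul_sum]
  refine HasDerivAt.fun_sum fun i hi => ?_
  have h1 : HasDerivAt (fun l => μ i + l) 1 l := (hasDerivAt_id l).const_add _
  have h2 := h i hi
  refine ((hasDerivAt_const l (c i)).div (h1.pow 2) (pow_ne_zero 2 h2)).congr_deriv ?_
  simp only [Pi.pow_apply]
  field_simp
  norm_num
  ring

/-- The quotient of a resolvent form by the square root of its quadratic counterpart is
increasing near `0⁺` if the logarithmic derivative at `0` is positive. -/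
theorem exists_forall_deriv_pos {K : ℝ} (hK : 0 < K) (hs : s.Nonempty)
    (hμ : ∀ i ∈ s, 0 < μ i) (hw : ∀ i ∈ s, w i ≠ 0)
    (h0 : (∑ i ∈ s, w i * g i / μ i ^ 2) * (∑ i ∈ s, w i ^ 2 / μ i) <
      (∑ i ∈ s, w i * g i / μ i) * (∑ i ∈ s, w i ^ 2 / μ i ^ 2)) :
    ∃ C : ℝ, 0 < C ∧ ∀ l : ℝ, 0 < l → l < C → ∃ d : ℝ, 0 < d ∧
      HasDerivAt (fun l => K * (∑ i ∈ s, w i * g i / (μ i + l)) /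
        √(∑ i ∈ s, μ i * w i ^ 2 / (μ i + l) ^ 2)) d l := by
  set N := fun l => ∑ i ∈ s, w i * g i / (μ i + l) with hN
  set N₂ := fun l => ∑ i ∈ s, w i * g i / (μ i + l) ^ 2 with hN₂
  set D := fun l => ∑ i ∈ s, μ i * w i ^ 2 / (μ i + l) ^ 2 with hD
  set D₃ := fun l => ∑ i ∈ s, μ i * w i ^ 2 / (μ i + l) ^ 3 with hD₃
  have hcont : ∀ (c : ι → ℝ) (m : ℕ), ContinuousAt (fun l => ∑ i ∈ s, c i / (μ i + l) ^ m) 0 := by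
    intro c m
    refine tendsto_finsetSum _ fun i hi => ?_
    have : (μ i + 0) ^ m ≠ 0 := by
      have := hμ i hi
      positivity
    exact ContinuousAt.div (by fun_prop) (by fun_prop) this
  have hN_cont : ContinuousAt N 0 := by simpa [hN] using hcont (fun i => w i * g i) 1
  -- Since `N' = -N₂` and `D' = -2 D₃`, the derivative of `K N / √D` is `K (N D₃ - N₂ D) / D^(3/2)`.
  have hΦ_cont : ContinuousAt (fun l => N l * D₃ l - N₂ l * D l) 0 :=
    (hN_cont.mul (hcont _ 3)).sub ((hcont _ 2).mul (hcont _ 2))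
  have hΦ : 0 < N 0 * D₃ 0 - N₂ 0 * D 0 := by
    have e1 : D 0 = ∑ i ∈ s, w i ^ 2 / μ i := Finset.sum_congr rfl fun i hi => by
      have := (hμ i hi).ne'
      rw [add_zero]
      field_simp
    have e2 : D₃ 0 = ∑ i ∈ s, w i ^ 2 / μ i ^ 2 := Finset.sum_congr rfl fun i hi => by
      have := (hμ i hi).ne'
      rw [add_zero]
      field_simp
    rw [e1, e2]
    simp only [hN, hN₂, add_zero]
    linarith
  obtain ⟨C, hC, hball⟩ := Metric.eventually_nhds_iff.1 (hΦ_cont.eventually (lt_mem_nhds hΦ))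
  refine ⟨C, hC, fun l hl hlC => ?_⟩
  have hpos : ∀ i ∈ s, 0 < μ i + l := fun i hi => add_pos (hμ i hi) hl
  have hDpos : 0 < D l := Finset.sum_pos (fun i hi => by
    have := hpos i hi
    have := hμ i hi
    have := hw i hi
    positivity) hs
  have hne : ∀ i ∈ s, μ i + l ≠ 0 := fun i hi => (hpos i hi).ne'
  have hlΦ : 0 < N l * D₃ l - N₂ l * D l :=
    hball (by rw [Real.dist_eq, sub_zero, abs_of_pos hl]; exact hlC)
  have hN' : HasDerivAt N (-N₂ l) l := hasDerivAt_sum_div_add s μ _ hne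
  have hD' : HasDerivAt D (-2 * D₃ l) l := hasDerivAt_sum_div_add_sq s μ _ hne
  have hsq : √(D l) ^ 2 = D l := Real.sq_sqrt hDpos.le
  have hsp : 0 < √(D l) := Real.sqrt_pos.2 hDpos
  refine ⟨K * (N l * D₃ l - N₂ l * D l) / √(D l) ^ 3, by positivity, ?_⟩
  refine ((hN'.const_mul K).div (hD'.sqrt hDpos.ne') hsp.ne').congr_deriv ?_
  generalize √(D l) = t at hsq hsp ⊢
  rw [← hsq]
  field_simp
  ring

theorem abs_mul_div_sq_le {C₂ C₃ ε m w g : ℝ} (hm : 0 < m) (hC₂ : 0 < C₂) (hC₃ : 0 < C₃)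
    (hw : w ^ 2 ≤ C₂ * m) (hg : g ^ 2 ≤ C₃ * m ^ (1 + ε)) :
    |w * g / m ^ 2| ≤ √(C₂ * C₃) * m ^ (ε / 2 - 1) := by
  have h1 : (m ^ (1 + ε / 2)) ^ 2 = m * m ^ (1 + ε) := by
    rw [← Real.rpow_natCast, ← Real.rpow_mul hm.le]
    nth_rewrite 2 [← Real.rpow_one m]
    rw [← Real.rpow_add hm]
    congr 1
    push_cast
    ring
  have h2 : |w * g| ≤ √(C₂ * C₃) * m ^ (1 + ε / 2) := by
    refine abs_le_of_sq_le_sq ?_ (by positivity)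
    rw [mul_pow, mul_pow, Real.sq_sqrt (by positivity), h1]
    calc w ^ 2 * g ^ 2 ≤ (C₂ * m) * (C₃ * m ^ (1 + ε)) := by gcongr
      _ = _ := by ring
  have h3 : m ^ (1 + ε / 2) = m ^ (ε / 2 - 1) * m ^ 2 := by
    rw [← Real.rpow_natCast, ← Real.rpow_add hm]
    congr 1
    push_cast
    ring
  rw [abs_div, abs_of_pos (pow_pos hm 2), div_le_iff₀ (pow_pos hm 2), mul_assoc, ← h3]
  exact h2

/-- The threshold on the smallest nonzero eigenvalue, in terms of a bound `k` on their number and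
the value `N₀` of the resolvent form at `0`. -/
noncomputable def eigThreshold (k C₁ C₂ C₃ ε N₀ M : ℝ) : ℝ :=
  if ε ≤ 2 then (N₀ * C₁ / (k ^ 2 * C₂ * √(C₂ * C₃))) ^ (2 / ε)
  else N₀ * C₁ / (k ^ 2 * C₂ * √(C₂ * C₃)) / max M 1 ^ (ε / 2 - 1)

theorem eigThreshold_pos {k C₁ C₂ C₃ ε N₀ M : ℝ} (hk : 0 < k) (hC₁ : 0 < C₁) (hC₂ : 0 < C₂)
    (hC₃ : 0 < C₃) (hN₀ : 0 < N₀) : 0 < eigThreshold k C₁ C₂ C₃ ε N₀ M := by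
  -- The maximum with `1` keeps the denominator positive whatever the sign of `M`.
  have : 0 < max M 1 := lt_max_of_lt_right one_pos
  unfold eigThreshold
  split_ifs <;> positivity

theorem logDeriv_numerator_pos {k C₁ C₂ C₃ ε M m : ℝ} (hk : (s.card : ℝ) ≤ k) (hC₁ : 0 < C₁)
    (hC₂ : 0 < C₂) (hC₃ : 0 < C₃) (hε : 0 < ε) (hμ : ∀ i ∈ s, 0 < μ i)
    (hw₁ : ∀ i ∈ s, C₁ * μ i ≤ w i ^ 2) (hw₂ : ∀ i ∈ s, w i ^ 2 ≤ C₂ * μ i)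
    (hg : ∀ i ∈ s, g i ^ 2 ≤ C₃ * μ i ^ (1 + ε)) (hM : 2 < ε → ∀ i ∈ s, μ i ≤ M)
    (hm : ∃ i ∈ s, μ i = m) (hm_le : ∀ i ∈ s, m ≤ μ i)
    (hN₀ : 0 < ∑ i ∈ s, w i * g i / μ i)
    (hlt : m < eigThreshold k C₁ C₂ C₃ ε (∑ i ∈ s, w i * g i / μ i) M) :
    (∑ i ∈ s, w i * g i / μ i ^ 2) * (∑ i ∈ s, w i ^ 2 / μ i) <
      (∑ i ∈ s, w i * g i / μ i) * (∑ i ∈ s, w i ^ 2 / μ i ^ 2) := by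
  obtain ⟨i₀, hi₀, rfl⟩ := hm
  set m := μ i₀
  have hm : 0 < m := hμ i₀ hi₀
  set N₀ := ∑ i ∈ s, w i * g i / μ i
  have hk0 : 0 < k := lt_of_lt_of_le (by exact_mod_cast Finset.card_pos.2 ⟨i₀, hi₀⟩) hk
  have hmax : 0 < max M 1 := lt_max_of_lt_right one_pos
  -- `B` bounds `μ ^ (ε / 2 - 1)` uniformly. For `ε ≤ 2` the exponent is nonpositive and the
  -- smallest eigenvalue is the worst case; for `ε > 2` an upper bound of the spectrum is needed.
  obtain ⟨B, hB, hBi, hBm⟩ : ∃ B : ℝ, 0 < B ∧ (∀ i ∈ s, μ i ^ (ε / 2 - 1) ≤ B) ∧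
      m * B < N₀ * C₁ / (k ^ 2 * C₂ * √(C₂ * C₃)) := by
    have hT : 0 < N₀ * C₁ / (k ^ 2 * C₂ * √(C₂ * C₃)) := by positivity
    set T := N₀ * C₁ / (k ^ 2 * C₂ * √(C₂ * C₃))
    rcases le_or_gt ε 2 with h | h
    · rw [eigThreshold, if_pos h] at hlt
      refine ⟨m ^ (ε / 2 - 1), by positivity, fun i hi =>
        Real.rpow_le_rpow_of_nonpos hm (hm_le i hi) (by linarith), ?_⟩
      have h1 : m * m ^ (ε / 2 - 1) = m ^ (ε / 2) := by
        nth_rewrite 1 [← Real.rpow_one m]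
        rw [← Real.rpow_add hm]
        congr 1
        ring
      rw [h1]
      calc m ^ (ε / 2) < (T ^ (2 / ε)) ^ (ε / 2) :=
            Real.rpow_lt_rpow hm.le hlt (by positivity)
        _ = T := by
          rw [← Real.rpow_mul hT.le, show 2 / ε * (ε / 2) = 1 by field_simp, Real.rpow_one]
    · rw [eigThreshold, if_neg h.not_ge, lt_div_iff₀ (by positivity)] at hlt
      exact ⟨max M 1 ^ (ε / 2 - 1), by positivity, fun i hi =>
        Real.rpow_le_rpow (hμ i hi).le ((hM h i hi).trans (le_max_left _ _)) (by linarith), hlt⟩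
  have hS₁ : ∑ i ∈ s, w i ^ 2 / μ i ≤ k * C₂ := by
    calc ∑ i ∈ s, w i ^ 2 / μ i ≤ ∑ i ∈ s, C₂ :=
          Finset.sum_le_sum fun i hi => (div_le_iff₀ (hμ i hi)).2 (hw₂ i hi)
      _ = s.card * C₂ := by simp
      _ ≤ k * C₂ := by gcongr
  have hQ : ∑ i ∈ s, w i * g i / μ i ^ 2 ≤ k * (√(C₂ * C₃) * B) := by
    calc ∑ i ∈ s, w i * g i / μ i ^ 2 ≤ ∑ i ∈ s, √(C₂ * C₃) * B :=
          Finset.sum_le_sum fun i hi => (le_abs_self _).trans <|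
            (abs_mul_div_sq_le (hμ i hi) hC₂ hC₃ (hw₂ i hi) (hg i hi)).trans <| by
              gcongr
              exact hBi i hi
      _ = s.card * (√(C₂ * C₃) * B) := by simp
      _ ≤ _ := by gcongr
  have hS₁0 : 0 ≤ ∑ i ∈ s, w i ^ 2 / μ i :=
    Finset.sum_nonneg fun i hi => div_nonneg (sq_nonneg _) (hμ i hi).le
  -- The term of the smallest eigenvalue alone already gives the blow-up `1 / m`.
  have hS₂ : C₁ / m ≤ ∑ i ∈ s, w i ^ 2 / μ i ^ 2 := by
    refine le_trans ?_ (Finset.single_le_sum (f := fun i => w i ^ 2 / μ i ^ 2)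
      (fun i hi => div_nonneg (sq_nonneg _) (sq_nonneg _)) hi₀)
    change C₁ / m ≤ w i₀ ^ 2 / m ^ 2
    rw [div_le_div_iff₀ hm (by positivity)]
    have := mul_le_mul_of_nonneg_right (hw₁ i₀ hi₀) hm.le
    change C₁ * m * m ≤ _ at this
    linarith
  calc (∑ i ∈ s, w i * g i / μ i ^ 2) * (∑ i ∈ s, w i ^ 2 / μ i)
      ≤ k * (√(C₂ * C₃) * B) * (k * C₂) := by gcongr
    _ < N₀ * (C₁ / m) := by
      rw [lt_div_iff₀ (by positivity)] at hBm
      rw [← mul_div_assoc, lt_div_iff₀ hm]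
      linarith
    _ ≤ _ := by gcongr

end CorrelationProfile

/-! ### Influence scores and the correlation in spectral form. -/

namespace Problem

variable {X Y : Type*} {n p : ℕ} {Q : Problem X Y n p}

theorem prob_eq_h {z : X × Y} {θ : Param p} (h : 0 < Q.h z.1 θ z.2) :
    Q.prob z θ = Q.h z.1 θ z.2 := by
  rw [prob, loss, neg_neg, Real.exp_log h]

theorem hasGradientAt_loss {z : X × Y} (h : 0 < Q.h z.1 Q.θS z.2)
    (hd : DifferentiableAt ℝ (fun θ => Q.h z.1 θ z.2) Q.θS) :
    HasGradientAt (fun θ => Q.loss z θ) (Q.gradLoss z) Q.θS :=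
  DifferentiableAt.hasGradientAt (hd.log h.ne').neg

/-- The output depends on `θ` only through the loss `t`, as `ln (e^(-t) / (1 - e^(-t)))`, whose
derivative in `t` is `-1 / (1 - e^(-t))`. -/
theorem gradOutput_eq {z : X × Y} (hz : Q.Regular z) :
    Q.gradOutput z = -(1 - Q.prob z Q.θS)⁻¹ • Q.gradLoss z := by
  have hL := (hasGradientAt_loss hz.full.1 hz.diff).hasFDerivAt
  have hq0 : 0 < Q.prob z Q.θS := Real.exp_pos _
  have hq1 : 0 < 1 - Q.prob z Q.θS := by
    rw [prob_eq_h hz.full.1]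
    linarith [hz.full.2]
  have hexp : HasDerivAt (fun t => Real.exp (-t)) (-Q.prob z Q.θS) (Q.loss z Q.θS) := by
    simpa [prob] using (hasDerivAt_id (Q.loss z Q.θS)).neg.exp
  have hφ : HasDerivAt (fun t => Real.log (Real.exp (-t) / (1 - Real.exp (-t))))
      (-(1 - Q.prob z Q.θS)⁻¹) (Q.loss z Q.θS) := by
    refine ((hexp.div (hexp.const_sub 1) hq1.ne').log (div_pos hq0 hq1).ne').congr_deriv ?_
    change (-Q.prob z Q.θS * (1 - Q.prob z Q.θS) - Q.prob z Q.θS * - -Q.prob z Q.θS) /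
      (1 - Q.prob z Q.θS) ^ 2 / (Q.prob z Q.θS / (1 - Q.prob z Q.θS)) = _
    field_simp
    ring
  refine HasGradientAt.gradient (hasGradientAt_iff_hasFDerivAt.2 ?_)
  refine (hφ.comp_hasFDerivAt _ hL).congr_fderiv ?_
  rw [map_smul]

theorem F_eigen {b : OrthonormalBasis (Fin p) ℝ (Param p)} {μ : Fin p → ℝ}
    (hb : Q.IsEigenbasis b μ) (i : Fin p) :
    ((1 / (n : ℝ)) • ∑ k, Matrix.vecMulVec (Q.gradLoss (Q.S k)).ofLp
      (Q.gradLoss (Q.S k)).ofLp) *ᵥ (b i).ofLp = μ i • (b i).ofLp :=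
  hb.eigen i

/-- First-order optimality of the fully trained parameter. -/
theorem sum_gradLoss_eq_zero [Fintype Y] (hQ : Q.WellPosed) : ∑ i, Q.gradLoss (Q.S i) = 0 := by
  have hn : (n : ℝ) ≠ 0 := by
    have := hQ.one_le_a
    have := hQ.a_le_n
    exact_mod_cast (by omega : n ≠ 0)
  have hpos : ∀ i, 0 < Q.h (Q.S i).1 Q.θS (Q.S i).2 := fun i =>
    hQ.min_full.1 i (Finset.mem_univ i)
  -- The minimum is only over parameters of finite risk; by continuity of the finitely many training
  -- probabilities these include a neighbourhood of `θS`.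
  have hmin : IsLocalMin (Q.risk Finset.univ) Q.θS := by
    have h : ∀ᶠ θ in 𝓝 Q.θS, ∀ i, 0 < Q.h (Q.S i).1 θ (Q.S i).2 :=
      eventually_all.2 fun i => (hQ.diff i).continuousAt.eventually (lt_mem_nhds (hpos i))
    filter_upwards [h] with θ hθ using hQ.min_full.2 θ fun i _ => hθ i
  have hder : HasFDerivAt (Q.risk Finset.univ)
      ((1 / ((Finset.univ : Finset (Fin n)).card : ℝ)) •
        ∑ i, InnerProductSpace.toDual ℝ (Param p) (Q.gradLoss (Q.S i))) Q.θS :=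
    (HasFDerivAt.fun_sum fun i _ =>
      (hasGradientAt_loss (hpos i) (hQ.diff i)).hasFDerivAt).const_mul _
  have h := hmin.hasFDerivAt_eq_zero hder
  rw [← map_sum, smul_eq_zero, or_iff_right (by simpa using hn)] at h
  exact (map_eq_zero_iff _ (InnerProductSpace.toDual ℝ (Param p)).injective).1 h

section Formulas

variable {b : OrthonormalBasis (Fin p) ℝ (Param p)} {μ : Fin p → ℝ} {z : X × Y}

theorem neg_gradOutput_resolvent (hb : Q.IsEigenbasis b μ) (hz : Q.Regular z) {l : ℝ}
    (hl : 0 < l) (v : Param p) :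
    -((Q.gradOutput z).ofLp ⬝ᵥ
      ((Q.F + l • (1 : Matrix (Fin p) (Fin p) ℝ))⁻¹ *ᵥ v.ofLp)) =
      (1 - Q.prob z Q.θS)⁻¹ *
        ∑ j, inner ℝ (b j) (Q.gradLoss z) * inner ℝ (b j) v / (μ j + l) := by
  rw [dotProduct_resolvent_mulVec hb.eigen fun i =>
    (add_pos_of_nonneg_of_pos (eigenvalue_nonneg (F_eigen hb) i) hl).ne', gradOutput_eq hz,
    Finset.mul_sum, ← Finset.sum_neg_distrib]
  refine Finset.sum_congr rfl fun j _ => ?_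
  rw [inner_smul_right]
  ring

theorem sum_iffim_eq_zero [Fintype Y] (hQ : Q.WellPosed) (l : ℝ) : ∑ i, Q.iffim l z i = 0 := by
  simp_rw [iffim]
  rw [Finset.sum_neg_distrib, ← dotProduct_sum, ← Matrix.mulVec_sum, ← WithLp.ofLp_sum,
    sum_gradLoss_eq_zero hQ]
  simp

theorem sum_iffim_mul_alpha [Fintype Y] (hQ : Q.WellPosed) (l : ℝ) :
    ∑ i, Q.iffim l z i * Q.alpha z i = n * Q.r z l := by
  have hn : (n : ℝ) ≠ 0 := by
    have := hQ.one_le_a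
    have := hQ.a_le_n
    exact_mod_cast (by omega : n ≠ 0)
  rw [r, g, WithLp.ofLp_smul, WithLp.ofLp_sum, Matrix.mulVec_smul, Matrix.mulVec_sum,
    dotProduct_smul, dotProduct_sum, smul_eq_mul, mul_neg, ← mul_assoc, mul_one_div_cancel hn,
    one_mul, ← Finset.sum_neg_distrib]
  refine Finset.sum_congr rfl fun i _ => ?_
  rw [iffim, WithLp.ofLp_smul, Matrix.mulVec_smul, dotProduct_smul, smul_eq_mul]
  ring

theorem sum_iffim_sq [Fintype Y] (hQ : Q.WellPosed) (hb : Q.IsEigenbasis b μ) (hz : Q.Regular z) {l : ℝ}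
    (hl : 0 < l) :
    ∑ i, Q.iffim l z i ^ 2 = (1 - Q.prob z Q.θS)⁻¹ ^ 2 * n *
      ∑ j, μ j * inner ℝ (b j) (Q.gradLoss z) ^ 2 / (μ j + l) ^ 2 := by
  have hn : n ≠ 0 := by
    have := hQ.one_le_a
    have := hQ.a_le_n
    omega
  have h := sum_sq_sum_mul_inner (F_eigen hb) hn
    fun j => inner ℝ (b j) (Q.gradLoss z) / (μ j + l)
  simp_rw [iffim, neg_gradOutput_resolvent hb hz hl, mul_pow, ← Finset.mul_sum]
  rw [mul_assoc]
  congr 1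
  simp_rw [div_pow, mul_div_assoc'] at h
  rw [← h]
  refine Finset.sum_congr rfl fun i _ => ?_
  congr 1
  exact Finset.sum_congr rfl fun j _ => by ring

/-- `g` is a combination of training gradients, which have no component in the kernel of `F`. This
removes the terms that could be singular as `λ → 0`. -/
theorem inner_g_eq_zero (hb : Q.IsEigenbasis b μ) {j : Fin p} (hj : μ j = 0) :
    inner ℝ (b j) (Q.g z) = 0 := by
  simp [g, inner_smul_right, inner_sum, inner_eq_zero_of_eigenvalue_eq_zero (F_eigen hb) hj]

/-- The indices of the nonzero eigenvalues. -/
noncomputable def spectralSupport (μ : Fin p → ℝ) : Finset (Fin p) := {j | μ j ≠ 0}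

theorem r_eq (hb : Q.IsEigenbasis b μ) (hz : Q.Regular z) {l : ℝ} (hl : 0 < l) :
    Q.r z l = (1 - Q.prob z Q.θS)⁻¹ * ∑ j ∈ spectralSupport μ,
      inner ℝ (b j) (Q.gradLoss z) * inner ℝ (b j) (Q.g z) / (μ j + l) := by
  rw [r, neg_gradOutput_resolvent hb hz hl]
  congr 1
  refine (Finset.sum_subset (Finset.subset_univ _) fun j _ hj => ?_).symm
  rw [inner_g_eq_zero hb (by simpa [spectralSupport] using hj), mul_zero, zero_div]

theorem tendsto_r (hb : Q.IsEigenbasis b μ) (hz : Q.Regular z) :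
    Tendsto (fun l => Q.r z l) (𝓝[>] 0) (𝓝 ((1 - Q.prob z Q.θS)⁻¹ *
      ∑ j ∈ spectralSupport μ,
        inner ℝ (b j) (Q.gradLoss z) * inner ℝ (b j) (Q.g z) / μ j)) := by
  have h : Tendsto (fun l => (1 - Q.prob z Q.θS)⁻¹ * ∑ j ∈ spectralSupport μ,
      inner ℝ (b j) (Q.gradLoss z) * inner ℝ (b j) (Q.g z) / (μ j + l)) (𝓝 0)
      (𝓝 ((1 - Q.prob z Q.θS)⁻¹ * ∑ j ∈ spectralSupport μ,
        inner ℝ (b j) (Q.gradLoss z) * inner ℝ (b j) (Q.g z) / μ j)) := by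
    refine (tendsto_finsetSum _ fun j hj => ?_).const_mul _
    have hj' : μ j ≠ 0 := by simpa [spectralSupport] using hj
    refine tendsto_const_nhds.div ?_ hj'
    simpa using (tendsto_id (α := ℝ) (x := 𝓝 0)).const_add (μ j)
  refine (h.mono_left nhdsWithin_le_nhds).congr' ?_
  filter_upwards [self_mem_nhdsWithin] with l hl using (r_eq hb hz hl).symm

theorem cp_eq [Fintype Y] (hQ : Q.WellPosed) (hb : Q.IsEigenbasis b μ) (hz : Q.Regular z)
    (hα : ∃ i, Q.alpha z i ≠ 0) :
    ∃ K : ℝ, 0 < K ∧ ∀ l, 0 < l → Q.cp z l =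
      K * (∑ j ∈ spectralSupport μ,
        inner ℝ (b j) (Q.gradLoss z) * inner ℝ (b j) (Q.g z) / (μ j + l)) /
      √(∑ j ∈ spectralSupport μ,
        μ j * inner ℝ (b j) (Q.gradLoss z) ^ 2 / (μ j + l) ^ 2) := by
  have ha := hQ.one_le_a
  have han := hQ.a_le_n
  obtain ⟨i, hi⟩ := hα
  set V := 𝔼 A ∈ Q.subsets, (Q.output z (Q.θs A) - 𝔼 B ∈ Q.subsets, Q.output z (Q.θs B)) ^ 2
    with hV
  have hV0 : V ≠ 0 := fun h => hi (condExpect_sub_expect_eq_zero ha han h i)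
  have hVpos : 0 < V := lt_of_le_of_ne (Finset.expect_nonneg fun _ _ => sq_nonneg _) hV0.symm
  -- For `a = n` there is a single subset, hence no variance. Strictness makes `(n - 2).choose (a -
  -- 1)` positive, so that `K > 0`.
  have hlt : Q.a < n := by
    refine lt_of_le_of_ne han fun h => hV0 ?_
    have hs : Q.subsets = {Finset.univ} := by
      rw [subsets, h, Finset.eq_singleton_iff_unique_mem]
      simpa using fun A hA => Finset.eq_univ_of_card A (by simpa using hA)
    rw [hV, hs]
    simp
  have hq : 0 < (1 - Q.prob z Q.θS)⁻¹ := by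
    rw [prob_eq_h hz.full.1]
    exact inv_pos.2 (by linarith [hz.full.2])
  have hn : (0 : ℝ) < n := by exact_mod_cast (by omega : 0 < n)
  have h0 : (0 : ℝ) < n.choose Q.a := by exact_mod_cast Nat.choose_pos han
  have h1 : (0 : ℝ) < (n - 1).choose (Q.a - 1) := by
    exact_mod_cast Nat.choose_pos (by omega)
  have h2 : (0 : ℝ) < (n - 2).choose (Q.a - 1) := by
    exact_mod_cast Nat.choose_pos (by omega)
  refine ⟨(n - 1).choose (Q.a - 1) / n.choose Q.a * n * (1 - Q.prob z Q.θS)⁻¹ /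
    (√V * √((n - 2).choose (Q.a - 1) / n.choose Q.a * ((1 - Q.prob z Q.θS)⁻¹ ^ 2 * n))),
    by positivity, fun l hl => ?_⟩
  have h := pearsonCorr_subset_sum ha han (fun A => Q.output z (Q.θs A))
    (sum_iffim_eq_zero (z := z) hQ l)
  have hD : ∑ j, μ j * inner ℝ (b j) (Q.gradLoss z) ^ 2 / (μ j + l) ^ 2 =
      ∑ j ∈ spectralSupport μ, μ j * inner ℝ (b j) (Q.gradLoss z) ^ 2 / (μ j + l) ^ 2 := by
    refine (Finset.sum_subset (Finset.subset_univ _) fun j _ hj => ?_).symm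
    rw [show μ j = 0 by simpa [spectralSupport] using hj, zero_mul, zero_div]
  rw [cp, pearsonLDS]
  refine h.trans ?_
  change _ * (∑ i, Q.iffim l z i * Q.alpha z i) / (√V * _) = _
  rw [sum_iffim_mul_alpha hQ, sum_iffim_sq hQ hb hz hl, hD, r_eq hb hz hl,
    ← mul_assoc (((n - 2).choose (Q.a - 1) : ℝ) / n.choose Q.a), Real.sqrt_mul (by positivity)]
  generalize √(∑ j ∈ spectralSupport μ,
    μ j * inner ℝ (b j) (Q.gradLoss z) ^ 2 / (μ j + l) ^ 2) = B
  generalize √(((n - 2).choose (Q.a - 1) : ℝ) / n.choose Q.a *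
    ((1 - Q.prob z Q.θS)⁻¹ ^ 2 * n)) = E
  generalize ∑ j ∈ spectralSupport μ,
    inner ℝ (b j) (Q.gradLoss z) * inner ℝ (b j) (Q.g z) / (μ j + l) = N
  simp only [div_eq_mul_inv, mul_inv]
  ring

end Formulas

theorem exists_limit_and_deriv_pos [Fintype Y] (hQ : Q.WellPosed)
    {b : OrthonormalBasis (Fin p) ℝ (Param p)} {μ : Fin p → ℝ} (hb : Q.IsEigenbasis b μ)
    {z : X × Y} (hz : Q.Regular z) {C₁ C₂ C₃ ε : ℝ} (hC₁ : 0 < C₁) (hC₂ : 0 < C₂)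
    (hC₃ : 0 < C₃) (hε : 0 < ε) (hconc : Q.Concentrated b C₁ C₂ z)
    (hg : Q.BoundedG b μ C₃ ε z) :
    ∃ r₀ : ℝ, Tendsto (fun l => Q.r z l) (𝓝[>] 0) (𝓝 r₀) ∧
      (0 < r₀ → ∀ M : ℝ, (2 < ε → ∀ i, μ i ≤ M) →
        ∀ μmin : ℝ, IsLeast {x | x ≠ 0 ∧ x ∈ Set.range μ} μmin →
          μmin < eigThreshold (n + 1) C₁ C₂ C₃ ε ((1 - Q.prob z Q.θS) * r₀) M →
          ∃ C : ℝ, 0 < C ∧ ∀ l : ℝ, 0 < l → l < C →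
            DifferentiableAt ℝ (fun l => Q.cp z l) l ∧ 0 < deriv (fun l => Q.cp z l) l) := by
  refine ⟨_, tendsto_r hb hz, fun hr M hM m hm hlt => ?_⟩
  have hq : 0 < 1 - Q.prob z Q.θS := by
    rw [prob_eq_h hz.full.1]
    linarith [hz.full.2]
  rw [mul_inv_cancel_left₀ hq.ne'] at hlt
  replace hr := (mul_pos_iff_of_pos_left (inv_pos.2 hq)).1 hr
  have hμ : ∀ j ∈ spectralSupport μ, 0 < μ j := fun j hj =>
    lt_of_le_of_ne (eigenvalue_nonneg (F_eigen hb) j)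
      (Ne.symm (by simpa [spectralSupport] using hj))
  have hidx : ∀ j ∈ spectralSupport μ, (j : ℕ) < n := fun j hj =>
    index_lt_of_eigenvalue_pos (F_eigen hb) hb.antitone (hμ j hj)
  have hcard : ((spectralSupport μ).card : ℝ) ≤ n + 1 := by
    have h : (spectralSupport μ).card ≤ (Finset.range n).card :=
      Finset.card_le_card_of_injOn (fun j => (j : ℕ))
        (fun j hj => by simpa using hidx j hj) (fun _ _ _ _ h => Fin.ext h)
    rw [Finset.card_range] at h
    have : ((spectralSupport μ).card : ℝ) ≤ n := by exact_mod_cast h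
    linarith
  have havg : ∀ j : Fin p,
      𝔼 k : Fin n, comp b (Q.gradLoss (Q.S k)) j ^ 2 = μ j := by
    intro j
    have h := average_inner_mul_inner (F_eigen hb) j j
    rw [if_pos rfl] at h
    rw [← h, Finset.expect_eq_sum_div_card]
    simp [comp, sq, div_eq_inv_mul]
  have hw : ∀ j ∈ spectralSupport μ, C₁ * μ j ≤ inner ℝ (b j) (Q.gradLoss z) ^ 2 ∧
      inner ℝ (b j) (Q.gradLoss z) ^ 2 ≤ C₂ * μ j := by
    intro j hj
    have h := hconc j (hidx j hj)
    rw [havg j] at h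
    simpa [comp] using h
  have hg' : ∀ j ∈ spectralSupport μ,
      inner ℝ (b j) (Q.g z) ^ 2 ≤ C₃ * μ j ^ (1 + ε) := by
    intro j hj
    simpa [comp, eig] using hg j (hidx j hj)
  have hmem : ∃ j ∈ spectralSupport μ, μ j = m := by
    obtain ⟨hm0, j, rfl⟩ := hm.1
    exact ⟨j, by simpa [spectralSupport] using hm0, rfl⟩
  have hne : (spectralSupport μ).Nonempty := hmem.imp fun _ h => h.1
  -- If `α` vanished, so would `g` and the limit of `r`, contradicting its positivity.
  have hα : ∃ i, Q.alpha z i ≠ 0 := by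
    by_contra! h
    have hg0 : Q.g z = 0 := by simp [g, h]
    simp [hg0] at hr
  obtain ⟨K, hK, hcp⟩ := cp_eq hQ hb hz hα
  obtain ⟨C, hC, hder⟩ := exists_forall_deriv_pos (spectralSupport μ) μ
    (fun j => inner ℝ (b j) (Q.gradLoss z)) (fun j => inner ℝ (b j) (Q.g z)) hK hne hμ
    (fun j hj h => by
      have := (hw j hj).1
      have := mul_pos hC₁ (hμ j hj)
      simp only [h] at *
      linarith)
    (logDeriv_numerator_pos _ _ _ _ hcard hC₁ hC₂ hC₃ hε hμ (fun j hj => (hw j hj).1)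
      (fun j hj => (hw j hj).2) hg' (fun h j _ => hM h j) hmem
      (fun j hj => hm.2 ⟨(hμ j hj).ne', j, rfl⟩) hr hlt)
  refine ⟨C, hC, fun l hl hlC => ?_⟩
  obtain ⟨d, hd, hdl⟩ := hder l hl hlC
  have hcp' : HasDerivAt (fun l => Q.cp z l) d l :=
    hdl.congr_of_eventuallyEq <| by
      filter_upwards [lt_mem_nhds hl] with t ht using hcp t ht
  exact ⟨hcp'.differentiableAt, hcp'.deriv ▸ hd⟩

end Problem

/-- `Cμ n C₁ C₂ C₃ ε r₀ q M` is the threshold on the smallest nonzero eigenvalue. It is fixed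
before the problem and sees the problem and the test example only through these numbers, and `M`
(an upper bound of the spectrum) plays a role only if `ε > 2`. -/
theorem lemma1 :
    ∃ Cμ : ℕ → ℝ → ℝ → ℝ → ℝ → ℝ → ℝ → ℝ → ℝ,
      (∀ (n : ℕ) (C₁ C₂ C₃ ε r₀ q M : ℝ), 0 < C₁ → C₁ < C₂ → 0 < C₃ → 0 < ε → 0 < r₀ →
        0 < q → q < 1 → 0 < Cμ n C₁ C₂ C₃ ε r₀ q M) ∧
      ∀ (X : Type*) (Y : Type*) [Fintype Y] [MeasurableSpace X] [MeasurableSpace Y] (n p : ℕ)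
        (Q : Problem X Y n p) (_ : Q.WellPosed)
        (b : OrthonormalBasis (Fin p) ℝ (Param p)) (μ : Fin p → ℝ) (_ : Q.IsEigenbasis b μ)
        (P : Measure (X × Y)) [IsProbabilityMeasure P] (δ : ℝ≥0∞)
        (_ : ∀ᵐ z ∂P, Q.Regular z)
        (C₁ C₂ : ℝ) (_ : 0 < C₁) (_ : C₁ < C₂)
        (_ : P {z | ¬ Q.Concentrated b C₁ C₂ z} ≤ δ)
        (C₃ ε : X × Y → ℝ) (_ : ∀ᵐ z ∂P, 0 < C₃ z ∧ 0 < ε z ∧ Q.BoundedG b μ (C₃ z) (ε z) z)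
        (_ : ∀ᵐ z ∂P, Q.AlphaInColumnSpace z),
        P {z | ¬ ∃ r₀ : ℝ, Tendsto (fun lam => Q.r z lam) (𝓝[>] 0) (𝓝 r₀) ∧
          (0 < r₀ → ∀ M : ℝ, (2 < ε z → ∀ i, μ i ≤ M) →
            ∀ μmin : ℝ, IsLeast {x | x ≠ 0 ∧ x ∈ Set.range μ} μmin →
              μmin < Cμ n C₁ C₂ (C₃ z) (ε z) r₀ (Q.prob z Q.θS) M →
              ∃ C : ℝ, 0 < C ∧ ∀ lam : ℝ, 0 < lam → lam < C →
                DifferentiableAt ℝ (fun l => Q.cp z l) lam ∧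
                0 < deriv (fun l => Q.cp z l) lam)} ≤ δ := by
  -- The factor `1 - q` turns `r₀` back into the bare sum `N(0)`; `n + 1` bounds the number of
  -- nonzero eigenvalues and keeps the threshold positive even at `n = 0`.
  refine ⟨fun n C₁ C₂ C₃ ε r₀ q M => eigThreshold (n + 1) C₁ C₂ C₃ ε ((1 - q) * r₀) M, ?_, ?_⟩
  · intro n C₁ C₂ C₃ ε r₀ q M hC₁ hC₁₂ hC₃ hε hr₀ hq hq1
    exact eigThreshold_pos (by positivity) hC₁ (hC₁.trans hC₁₂) hC₃
      (mul_pos (sub_pos.2 hq1) hr₀)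
  · intro X Y _ _ _ n p Q hQ b μ hb P _ δ hreg C₁ C₂ hC₁ hC₁₂ hconc C₃ ε hg _
    refine (measure_mono_ae ?_).trans hconc
    filter_upwards [hreg, hg] with z hz ⟨hC₃, hε, hgz⟩ hzn hzc
    exact hzn (Problem.exists_limit_and_deriv_pos hQ hb hz hC₁ (hC₁.trans hC₁₂) hC₃ hε hzc hgz)
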